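/- Let $\mathsf{Ban}$ be the category whose objects are the real Banach spaces and whose morphisms $X\to Y$ are the short linear maps, i.e. the linear maps of operator norm at most $1$. Equip each hom-set $\mathsf{Ban}(X,Y)$ with the metric of the operator norm, $d(S,T)=\|S-T\|=\sup\{\|(S-T)(x)\| : \|x\|\le 1\}$. Let $X\widehat{\otimes}_\pi Y$ be the projective tensor product, i.e. the completion of the algebraic tensor product $X\otimes Y$ for the projective norm $\pi(t)=\inf\{\sum_i\|x_i\|\|y_i\| : t=\sum_i x_i\otimes y_i\}$ (finite sums), and let $Y\multimap Z$ be the Banach space of all bounded linear maps $Y\to Z$ with the operator norm. Then $\mathsf{Ban}$ is a $\mathsf{Met}$-enriched autonomous category, where $\mathsf{Met}$ is the category of extended metric spaces and short (non-expansive) maps, with the product with the sum of the distances as its tensor. That is: 1. (Autonomous.) $\mathsf{Ban}$ is a symmetric monoidal category with tensor $\widehat{\otimes}_\pi$ and unit $\mathbb{R}$, where $(f\widehat{\otimes}_\pi g)(x\otimes x')=f(x)\otimes g(x')$ and the structural isomorphisms are given on elementary tensors by $(x\otimes y)\otimes z\mapsto x\otimes(y\otimes z)$, $r\otimes x\mapsto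 rx$, $x\otimes r\mapsto rx$ and $x\otimes y\mapsto y\otimes x$. For every $Y$ the functor $-\widehat{\otimes}_\pi Y$ is left adjoint to the functor $Y\multimap -$ (acting on morphisms by $S\mapsto (T\mapsto S\circ T)$), through currying: $f: X\widehat{\otimes}_\pi Y\to Z$ corresponds to $\bar f:X\to (Y\multimap Z)$ with $\bar f(x)(y)=f(x\otimes y)$. 2. (Composition is short.) $d(S\circ T,S'\circ T')\le d(T,T')+d(S,S')$ for all $T,T'\in\mathsf{Ban}(X,Y)$ and $S,S'\in\mathsf{Ban}(Y,Z)$. 3. (The tensor is short.) $d(S\widehat{\otimes}_\pi T,\,S'\widehat{\otimes}_\pi T')\le d(S,S')+d(T,T')$ for all $S,S'\in\mathsf{Ban}(X,Y)$ and $T,T'\in\mathsf{Ban}(X',Y')$. 4. (The adjunction is $\mathsf{Met}$-enriched.) For every $Y$ the functors $-\widehat{\otimes}_\pi Y$ and $Y\multimap -$ act on each hom-set by a short map, and the currying bijection $\mathsf{Ban}(X\widehat{\otimes}_\pi Y,Z)\to\mathsf{Ban}(X,Y\multimap Z)$ is an isometry for all $X$ and $Z$. -/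

import Mathlib

open CategoryTheory MonoidalCategory

universe v₁ v₂ u₁ u₂ u

/-! ### Categories enriched over `Met`, the category of extended metric spaces and short maps

`Met` is monoidal with `A ⊗ B` the product `A × B` with the *sum* of the two distances.  A map out of
`A ⊗ B` is therefore short when `edist (h (a, b)) (h (a', b')) ≤ edist a a' + edist b b'`. -/

section MetEnriched

/-- A `Met`-category: every hom-set is an extended metric space and composition is a short map
`C(X, Y) ⊗ C(Y, Z) → C(X, Z)`. -/
def IsMetCategory (C : Type u₁) [Category.{v₁} C] [∀ X Y : C, EMetricSpace (X ⟶ Y)] : Prop :=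
  ∀ (X Y Z : C) (f f' : X ⟶ Y) (g g' : Y ⟶ Z),
    edist (f ≫ g) (f' ≫ g') ≤ edist f f' + edist g g'

/-- A `Met`-functor: a functor that acts on each hom-set by a short map. -/
def IsMetFunctor {C : Type u₁} [Category.{v₁} C] [∀ X Y : C, EMetricSpace (X ⟶ Y)]
    {D : Type u₂} [Category.{v₂} D] [∀ X Y : D, EMetricSpace (X ⟶ Y)] (F : C ⥤ D) : Prop :=
  ∀ X Y : C, LipschitzWith 1 (fun f : X ⟶ Y => F.map f)

/-- A `Met`-adjunction: both functors are `Met`-functors, and the (natural) bijections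
`D(F X, Y) ≃ C(X, G Y)` are isomorphisms in `Met`, that is, bijective isometries. -/
structure IsMetAdjunction {C : Type u₁} [Category.{v₁} C] [∀ X Y : C, EMetricSpace (X ⟶ Y)]
    {D : Type u₂} [Category.{v₂} D] [∀ X Y : D, EMetricSpace (X ⟶ Y)]
    {F : C ⥤ D} {G : D ⥤ C} (adj : F ⊣ G) : Prop where
  left : IsMetFunctor F
  right : IsMetFunctor G
  isometry : ∀ (X : C) (Y : D), Isometry (adj.homEquiv X Y)

/-- The bifunctor `⊗ : C × C ⥤ C` is a `Met`-functor, where `(C × C)((X, X'), (Y, Y'))` is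
`C(X, Y) ⊗ C(X', Y')`. -/
def IsMetTensor (C : Type u₁) [Category.{v₁} C] [MonoidalCategory C]
    [∀ X Y : C, EMetricSpace (X ⟶ Y)] : Prop :=
  ∀ (X Y X' Y' : C) (f g : X ⟶ Y) (f' g' : X' ⟶ Y'),
    edist (f ⊗ₘ f') (g ⊗ₘ g') ≤ edist f g + edist f' g'

/-- A symmetric monoidal category `C` that is closed through the adjunctions
`(- ⊗ X) ⊣ (X ⊸ -)` (that is, an autonomous category) is a `Met`-enriched autonomous category. -/
structure IsMetEnrichedAutonomous (C : Type u₁) [Category.{v₁} C] [MonoidalCategory C]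
    [SymmetricCategory C] [∀ X Y : C, EMetricSpace (X ⟶ Y)]
    (lhom : C → C ⥤ C) (adj : ∀ X : C, tensorRight X ⊣ lhom X) : Prop where
  metCategory : IsMetCategory C
  metTensor : IsMetTensor C
  metAdjunction : ∀ X : C, IsMetAdjunction (adj X)

end MetEnriched

/-! ### The category of Banach spaces and short linear maps -/

/-- Real Banach spaces. -/
structure Ban : Type (u + 1) where
  carrier : Type u
  [normedAddCommGroup : NormedAddCommGroup carrier]
  [normedSpace : NormedSpace ℝ carrier]
  [completeSpace : CompleteSpace carrier]

namespace Ban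

instance : CoeSort Ban.{u} (Type u) := ⟨Ban.carrier⟩

attribute [instance] normedAddCommGroup normedSpace completeSpace

/-- Short linear maps: (continuous) linear maps of operator norm at most one. -/
@[ext]
structure Hom (X Y : Ban.{u}) where
  toCLM : X →L[ℝ] Y
  norm_le : ‖toCLM‖ ≤ 1

instance : Category Ban.{u} where
  Hom X Y := Hom X Y
  id X := ⟨ContinuousLinearMap.id ℝ X, ContinuousLinearMap.norm_id_le⟩
  comp f g := ⟨g.toCLM.comp f.toCLM,
    (ContinuousLinearMap.opNorm_comp_le _ _).trans
      (mul_le_one₀ g.norm_le (norm_nonneg _) f.norm_le)⟩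

/-- The bounded linear map underlying a morphism of `Ban`. -/
def clm {X Y : Ban.{u}} (f : X ⟶ Y) : X →L[ℝ] Y := Hom.toCLM f

theorem clm_injective (X Y : Ban.{u}) :
    Function.Injective (fun f : X ⟶ Y => clm f) :=
  fun _ _ h => Hom.ext h

/-- The metric of the operator norm on hom-sets, `d(S, T) = ‖S - T‖`. -/
noncomputable instance (X Y : Ban.{u}) : EMetricSpace (X ⟶ Y) :=
  EMetricSpace.induced (fun f : X ⟶ Y => clm f) (clm_injective X Y) inferInstance

theorem norm_postcomp_le {E F G : Type u} [NormedAddCommGroup E] [NormedSpace ℝ E]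
    [NormedAddCommGroup F] [NormedSpace ℝ F] [NormedAddCommGroup G] [NormedSpace ℝ G]
    (S : F →L[ℝ] G) (hS : ‖S‖ ≤ 1) : ‖ContinuousLinearMap.compL ℝ E F G S‖ ≤ 1 :=
  ContinuousLinearMap.opNorm_le_bound _ zero_le_one fun T =>
    (ContinuousLinearMap.opNorm_comp_le S T).trans
      (mul_le_mul_of_nonneg_right hS (norm_nonneg T))

/-- The functor `Y ⊸ -`: the Banach space `Y ⊸ Z` consists of all bounded linear maps `Y → Z`, with
the operator norm, and `Y ⊸ S` is the post-composition `T ↦ S ∘ T`. -/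
noncomputable def lhom (Y : Ban.{u}) : Ban.{u} ⥤ Ban.{u} where
  obj Z := Ban.mk (Y →L[ℝ] Z)
  map {Z Z'} S :=
    Hom.mk (ContinuousLinearMap.compL ℝ Y Z Z' (clm S)) (norm_postcomp_le (clm S) S.norm_le)
  map_id _ := rfl
  map_comp _ _ := rfl

/-- A point of `Y ⊸ Z`, seen as the bounded linear map that it is. -/
def asMap {Y Z : Ban.{u}} (T : ((lhom Y).obj Z : Ban.{u})) : Y →L[ℝ] Z := T

/-! ### The projective tensor product -/

/-- The projective norm of an element `t` of the algebraic tensor product: the infimum of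
`∑ ‖xᵢ‖ ‖yᵢ‖` over all representations `t = ∑ xᵢ ⊗ yᵢ` as a finite sum. -/
noncomputable def projectiveNorm {X Y : Ban.{u}} (t : TensorProduct ℝ X Y) : ℝ :=
  sInf {r : ℝ | ∃ (n : ℕ) (x : Fin n → X) (y : Fin n → Y),
    t = ∑ i, TensorProduct.tmul ℝ (x i) (y i) ∧ r = ∑ i, ‖x i‖ * ‖y i‖}

/-- The Banach space `T` with the bilinear map `τ : X × Y → T` is the projective tensor product of
`X` and `Y`: the completion of the algebraic tensor product for the projective norm. -/
structure IsProjectiveTensor {X Y T : Ban.{u}} (τ : X →ₗ[ℝ] Y →ₗ[ℝ] T) : Prop where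
  norm_lift : ∀ t : TensorProduct ℝ X Y, ‖TensorProduct.lift τ t‖ = projectiveNorm t
  denseRange_lift : DenseRange (TensorProduct.lift τ)

/-- The symmetric monoidal structure on `Ban` is the one of the projective tensor product, with
`τ x y` the elementary tensor `x ⊗ y`: tensor products of maps and all structural isomorphisms take
their usual values on elementary tensors (whose span is dense), and the unit is `ℝ`. -/
structure IsProjectiveMonoidal [MonoidalCategory Ban.{u}] [SymmetricCategory Ban.{u}]
    (ι : ℝ ≃ₗᵢ[ℝ] (𝟙_ Ban.{u} : Ban.{u}))
    (τ : ∀ X Y : Ban.{u}, X →ₗ[ℝ] Y →ₗ[ℝ] (X ⊗ Y : Ban.{u})) : Prop where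
  isProjectiveTensor : ∀ X Y : Ban.{u}, IsProjectiveTensor (τ X Y)
  tensorHom_apply : ∀ {X Y X' Y' : Ban.{u}} (f : X ⟶ Y) (g : X' ⟶ Y') (x : X) (x' : X'),
    clm (f ⊗ₘ g) (τ X X' x x') = τ Y Y' (clm f x) (clm g x')
  associator_apply : ∀ (X Y Z : Ban.{u}) (x : X) (y : Y) (z : Z),
    clm (α_ X Y Z).hom (τ (X ⊗ Y) Z (τ X Y x y) z) = τ X (Y ⊗ Z) x (τ Y Z y z)
  leftUnitor_apply : ∀ (X : Ban.{u}) (r : ℝ) (x : X),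
    clm (λ_ X).hom (τ (𝟙_ Ban.{u}) X (ι r) x) = r • x
  rightUnitor_apply : ∀ (X : Ban.{u}) (r : ℝ) (x : X),
    clm (ρ_ X).hom (τ X (𝟙_ Ban.{u}) x (ι r)) = r • x
  braiding_apply : ∀ (X Y : Ban.{u}) (x : X) (y : Y),
    clm (β_ X Y).hom (τ X Y x y) = τ Y X y x

/-- The adjunctions `(- ⊗ Y) ⊣ (Y ⊸ -)` are given by currying: `f : X ⊗ Y → Z` corresponds to the
map `X → (Y ⊸ Z)`, `x ↦ (y ↦ f (x ⊗ y))`. -/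
def IsCurrying [MonoidalCategory Ban.{u}]
    (τ : ∀ X Y : Ban.{u}, X →ₗ[ℝ] Y →ₗ[ℝ] (X ⊗ Y : Ban.{u}))
    (adj : ∀ Y : Ban.{u}, tensorRight Y ⊣ lhom Y) : Prop :=
  ∀ (X Y Z : Ban.{u}) (f : X ⊗ Y ⟶ Z) (x : X) (y : Y),
    asMap (clm ((adj Y).homEquiv X Z f) x) y = clm f (τ X Y x y)

end Ban

namespace Ban

/-! Everything rests on one isometry, `uncurry`: bounded bilinear maps on `X × Y` are the bounded
linear maps on the projective tensor product, with equal norms. The projective norm makes a bilinear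
`b` induce a linear map of norm at most `‖b‖` (`norm_lift_le_mul_projectiveNorm`), which extends to
the completion. Since `‖x ⊗ y‖ ≤ ‖x‖ * ‖y‖`, restricting back to elementary tensors does not
increase the norm either.

Currying is therefore bijective and isometric on hom-sets. Elementary tensors have dense span, so
bounded maps agreeing on them are equal (`clm_tensor_ext`), which settles every coherence law.
Composition and tensor are short by the telescoping `S T - S' T' = S (T - T') + (S - S') T'` and its
analogue for the tensor, all maps having norm at most one. -/

@[simp]
theorem clm_id (X : Ban.{u}) : clm (𝟙 X) = ContinuousLinearMap.id ℝ X := rfl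

@[simp]
theorem clm_comp {X Y Z : Ban.{u}} (f : X ⟶ Y) (g : Y ⟶ Z) :
    clm (f ≫ g) = (clm g).comp (clm f) := rfl

theorem norm_clm_le {X Y : Ban.{u}} (f : X ⟶ Y) : ‖clm f‖ ≤ 1 := Hom.norm_le f

theorem norm_clm_apply_le {X Y : Ban.{u}} (f : X ⟶ Y) (x : X) : ‖clm f x‖ ≤ ‖x‖ :=
  (clm f).le_of_opNorm_le_of_le (norm_clm_le f) le_rfl |>.trans (one_mul _).le

/-! ### Distances in hom-sets -/

theorem edist_hom_eq {X Y : Ban.{u}} (f g : X ⟶ Y) :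
    edist f g = ENNReal.ofReal ‖clm f - clm g‖ := by
  change edist (clm f) (clm g) = _
  rw [edist_dist, dist_eq_norm]

theorem edist_hom_le_add {X Y X₁ Y₁ X₂ Y₂ : Ban.{u}} {f g : X ⟶ Y} {f₁ g₁ : X₁ ⟶ Y₁}
    {f₂ g₂ : X₂ ⟶ Y₂}
    (h : ‖clm f - clm g‖ ≤ ‖clm f₁ - clm g₁‖ + ‖clm f₂ - clm g₂‖) :
    edist f g ≤ edist f₁ g₁ + edist f₂ g₂ := by
  rw [edist_hom_eq, edist_hom_eq, edist_hom_eq,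
    ← ENNReal.ofReal_add (norm_nonneg _) (norm_nonneg _)]
  exact ENNReal.ofReal_le_ofReal h

theorem isMetCategory : IsMetCategory Ban.{u} := by
  intro X Y Z f f' g g'
  refine edist_hom_le_add ?_
  have h : clm (f ≫ g) - clm (f' ≫ g') =
      (clm g).comp (clm f - clm f') + (clm g - clm g').comp (clm f') := by
    ext x; simp
  rw [h]
  refine (norm_add_le _ _).trans (add_le_add ?_ ?_)
  · exact (ContinuousLinearMap.opNorm_comp_le _ _).trans
      (mul_le_of_le_one_left (norm_nonneg _) (norm_clm_le g))
  · exact (ContinuousLinearMap.opNorm_comp_le _ _).trans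
      (mul_le_of_le_one_right (norm_nonneg _) (norm_clm_le f'))

theorem isMetFunctor_lhom (Y : Ban.{u}) : IsMetFunctor (lhom Y) := by
  intro Z Z' S S'
  rw [ENNReal.coe_one, one_mul, edist_hom_eq, edist_hom_eq]
  refine ENNReal.ofReal_le_ofReal (ContinuousLinearMap.opNorm_le_bound _ (norm_nonneg _) ?_)
  intro T
  exact ContinuousLinearMap.opNorm_comp_le (clm S - clm S') (asMap T)

/-! ### The projective seminorm on the algebraic tensor product -/

section ProjectiveNorm

variable {X Y : Ban.{u}}

open TensorProduct

theorem exists_eq_sum_tmul (t : X ⊗[ℝ] Y) :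
    ∃ (n : ℕ) (x : Fin n → X) (y : Fin n → Y), t = ∑ i, x i ⊗ₜ[ℝ] y i := by
  induction t with
  | zero => exact ⟨0, Fin.elim0, Fin.elim0, by simp⟩
  | tmul x y => exact ⟨1, fun _ => x, fun _ => y, by simp⟩
  | add s t hs ht =>
    obtain ⟨n, x, y, rfl⟩ := hs
    obtain ⟨m, x', y', rfl⟩ := ht
    exact ⟨n + m, Fin.append x x', Fin.append y y', by simp [Fin.sum_univ_add]⟩

theorem projectiveNorm_le_sum {t : X ⊗[ℝ] Y} {n : ℕ} {x : Fin n → X} {y : Fin n → Y}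
    (h : t = ∑ i, x i ⊗ₜ[ℝ] y i) : projectiveNorm t ≤ ∑ i, ‖x i‖ * ‖y i‖ := by
  refine csInf_le ⟨0, ?_⟩ ⟨n, x, y, h, rfl⟩
  rintro _ ⟨m, x, y, -, rfl⟩
  positivity

theorem le_projectiveNorm {t : X ⊗[ℝ] Y} {c : ℝ}
    (h : ∀ (n : ℕ) (x : Fin n → X) (y : Fin n → Y), t = ∑ i, x i ⊗ₜ[ℝ] y i →
      c ≤ ∑ i, ‖x i‖ * ‖y i‖) : c ≤ projectiveNorm t := by
  obtain ⟨n, x, y, ht⟩ := exists_eq_sum_tmul t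
  -- A representation must be exhibited: the real infimum of the empty set is `0` by convention, so
  -- the bound could fail without one.
  refine le_csInf ⟨_, n, x, y, ht, rfl⟩ ?_
  rintro _ ⟨m, x, y, h', rfl⟩
  exact h m x y h'

theorem projectiveNorm_nonneg (t : X ⊗[ℝ] Y) : 0 ≤ projectiveNorm t :=
  le_projectiveNorm fun _ _ _ _ => by positivity

theorem projectiveNorm_tmul_le (x : X) (y : Y) : projectiveNorm (x ⊗ₜ[ℝ] y) ≤ ‖x‖ * ‖y‖ := by
  simpa using projectiveNorm_le_sum (t := x ⊗ₜ[ℝ] y) (n := 1) (x := fun _ => x) (y := fun _ => y)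
    (by simp)

theorem projectiveNorm_add_le (s t : X ⊗[ℝ] Y) :
    projectiveNorm (s + t) ≤ projectiveNorm s + projectiveNorm t := by
  -- The two infima are taken one after the other; concatenating a representation of `s` with one of
  -- `t` represents `s + t`.
  rw [← sub_le_iff_le_add]
  refine le_projectiveNorm fun n x y hs => ?_
  rw [sub_le_comm]
  refine le_projectiveNorm fun m x' y' ht => ?_
  rw [sub_le_iff_le_add']
  refine (projectiveNorm_le_sum (x := Fin.append x x') (y := Fin.append y y') ?_).trans_eq ?_
  · simp [Fin.sum_univ_add, hs, ht]
  · simp [Fin.sum_univ_add]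

theorem projectiveNorm_smul_le (c : ℝ) (t : X ⊗[ℝ] Y) :
    projectiveNorm (c • t) ≤ ‖c‖ * projectiveNorm t := by
  rcases eq_or_ne c 0 with rfl | hc
  · simpa using projectiveNorm_tmul_le (0 : X) (0 : Y)
  · rw [← div_le_iff₀' (norm_pos_iff.2 hc)]
    refine le_projectiveNorm fun n x y ht => ?_
    rw [div_le_iff₀' (norm_pos_iff.2 hc)]
    refine (projectiveNorm_le_sum (x := fun i => c • x i) (y := y) ?_).trans_eq ?_
    · simp [ht, Finset.smul_sum, smul_tmul']
    · simp [Finset.mul_sum, norm_smul, mul_assoc]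

theorem projectiveNorm_smul (c : ℝ) (t : X ⊗[ℝ] Y) :
    projectiveNorm (c • t) = ‖c‖ * projectiveNorm t := by
  refine (projectiveNorm_smul_le c t).antisymm ?_
  rcases eq_or_ne c 0 with rfl | hc
  · simpa using projectiveNorm_nonneg ((0 : ℝ) • t)
  -- The reverse inequality is the first one applied to the inverse scalar.
  · have h := projectiveNorm_smul_le c⁻¹ (c • t)
    rwa [inv_smul_smul₀ hc, norm_inv, inv_mul_eq_div, le_div_iff₀' (norm_pos_iff.2 hc)] at h

/-- The triangle inequality gives the bound for each representation of `t`, and the infimum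
preserves it. The case `C = 0` is separate because the argument divides by `C`. -/
theorem norm_lift_le_mul_projectiveNorm {E : Type*} [NormedAddCommGroup E] [NormedSpace ℝ E]
    (b : X →ₗ[ℝ] Y →ₗ[ℝ] E) {C : ℝ} (hC : 0 ≤ C) (hb : ∀ x y, ‖b x y‖ ≤ C * (‖x‖ * ‖y‖))
    (t : X ⊗[ℝ] Y) : ‖TensorProduct.lift b t‖ ≤ C * projectiveNorm t := by
  rcases hC.eq_or_lt with rfl | hC
  · obtain ⟨n, x, y, rfl⟩ := exists_eq_sum_tmul t
    rw [zero_mul, map_sum]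
    refine (norm_sum_le _ _).trans (Finset.sum_nonpos fun i _ => ?_)
    simpa using hb (x i) (y i)
  · rw [← div_le_iff₀' hC]
    refine le_projectiveNorm fun n x y ht => ?_
    rw [div_le_iff₀' hC, ht, map_sum, Finset.mul_sum]
    exact (norm_sum_le _ _).trans (Finset.sum_le_sum fun i _ => by simpa using hb (x i) (y i))

end ProjectiveNorm

/-! ### The projective tensor product as a completion -/

/-- The algebraic tensor product, to be seminormed by the projective norm. -/
def AlgTensor (X Y : Ban.{u}) : Type u := TensorProduct ℝ X Y

section Tensor

variable {X Y Z : Ban.{u}}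

noncomputable instance : AddCommGroup (AlgTensor X Y) :=
  inferInstanceAs (AddCommGroup (TensorProduct ℝ X Y))

noncomputable instance : Module ℝ (AlgTensor X Y) :=
  inferInstanceAs (Module ℝ (TensorProduct ℝ X Y))

noncomputable instance : Norm (AlgTensor X Y) := ⟨projectiveNorm (X := X) (Y := Y)⟩

/-- A seminorm suffices: the completion is Hausdorff, so definiteness of the projective norm need
not be proved. -/
theorem seminormedSpaceCore_algTensor (X Y : Ban.{u}) :
    SeminormedSpace.Core ℝ (AlgTensor X Y) where
  norm_nonneg := projectiveNorm_nonneg (X := X) (Y := Y)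
  norm_smul := projectiveNorm_smul (X := X) (Y := Y)
  norm_triangle := projectiveNorm_add_le (X := X) (Y := Y)

noncomputable instance : SeminormedAddCommGroup (AlgTensor X Y) :=
  SeminormedAddCommGroup.ofCore (seminormedSpaceCore_algTensor X Y)

noncomputable instance : NormedSpace ℝ (AlgTensor X Y) where
  norm_smul_le c t := (projectiveNorm_smul (X := X) (Y := Y) c t).le

/-- The projective tensor product of two Banach spaces. -/
noncomputable def tensor (X Y : Ban.{u}) : Ban.{u} :=
  Ban.mk (UniformSpace.Completion (AlgTensor X Y))

/-- The map from the algebraic tensor product to the projective tensor product. -/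
noncomputable def ofAlg (X Y : Ban.{u}) : TensorProduct ℝ X Y →ₗ[ℝ] tensor X Y :=
  (UniformSpace.Completion.toComplₗᵢ (𝕜 := ℝ) (E := AlgTensor X Y)).toLinearMap

theorem norm_ofAlg (t : TensorProduct ℝ X Y) : ‖ofAlg X Y t‖ = projectiveNorm t :=
  (UniformSpace.Completion.toComplₗᵢ (𝕜 := ℝ) (E := AlgTensor X Y)).norm_map t

theorem denseRange_ofAlg (X Y : Ban.{u}) : DenseRange (ofAlg X Y) :=
  UniformSpace.Completion.denseRange_coe (α := AlgTensor X Y)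

/-- The elementary tensors, as a bounded bilinear map. -/
noncomputable def tmul (X Y : Ban.{u}) : X →L[ℝ] Y →L[ℝ] tensor X Y :=
  ((TensorProduct.mk ℝ X Y).compr₂ (ofAlg X Y)).mkContinuous₂ 1 fun x y => by
    rw [one_mul]
    exact (norm_ofAlg _).trans_le (projectiveNorm_tmul_le x y)

theorem norm_tmul_le (x : X) (y : Y) : ‖tmul X Y x y‖ ≤ ‖x‖ * ‖y‖ :=
  (norm_ofAlg _).trans_le (projectiveNorm_tmul_le x y)

/-- The elementary tensors, as an algebraic bilinear map. -/
noncomputable def tmulₗ (X Y : Ban.{u}) : X →ₗ[ℝ] Y →ₗ[ℝ] tensor X Y :=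
  (TensorProduct.mk ℝ X Y).compr₂ (ofAlg X Y)

theorem lift_tmulₗ (X Y : Ban.{u}) : TensorProduct.lift (tmulₗ X Y) = ofAlg X Y :=
  TensorProduct.ext' fun _ _ => rfl

theorem isProjectiveTensor_tmulₗ (X Y : Ban.{u}) : IsProjectiveTensor (tmulₗ X Y) where
  norm_lift t := by rw [lift_tmulₗ, norm_ofAlg]
  denseRange_lift := by rw [lift_tmulₗ]; exact denseRange_ofAlg X Y

/-! ### Universal property and extensionality -/

theorem clm_tensor_ext {E : Type*} [NormedAddCommGroup E] [NormedSpace ℝ E]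
    {f g : tensor X Y →L[ℝ] E} (h : ∀ x y, f (tmul X Y x y) = g (tmul X Y x y)) : f = g := by
  have h' : f.toLinearMap ∘ₗ ofAlg X Y = g.toLinearMap ∘ₗ ofAlg X Y := TensorProduct.ext' h
  exact ContinuousLinearMap.coeFn_injective <|
    (denseRange_ofAlg X Y).equalizer f.continuous g.continuous
      (funext fun t => LinearMap.congr_fun h' t)

/-- This is the estimate that permits extension by continuity along `ofAlg`; it also makes the lift
vanish wherever the seminorm does. -/
theorem norm_lift_le_mul_norm_ofAlg (b : X →L[ℝ] Y →L[ℝ] Z) (t : TensorProduct ℝ X Y) :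
    ‖TensorProduct.lift b.toLinearMap₁₂ t‖ ≤ ‖b‖ * ‖ofAlg X Y t‖ := by
  rw [norm_ofAlg]
  exact norm_lift_le_mul_projectiveNorm _ (norm_nonneg b)
    (fun x y => (b.le_opNorm₂ x y).trans_eq (mul_assoc _ _ _)) t

/-- The bounded linear map on the projective tensor product induced by a bounded bilinear map. -/
noncomputable def uncurryCLM (b : X →L[ℝ] Y →L[ℝ] Z) : tensor X Y →L[ℝ] Z :=
  (TensorProduct.lift b.toLinearMap₁₂).extendOfNorm (ofAlg X Y)

@[simp]
theorem uncurryCLM_tmul (b : X →L[ℝ] Y →L[ℝ] Z) (x : X) (y : Y) :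
    uncurryCLM b (tmul X Y x y) = b x y :=
  (LinearMap.extendOfNorm_eq (denseRange_ofAlg X Y) ⟨_, norm_lift_le_mul_norm_ofAlg b⟩ _).trans
    (TensorProduct.lift.tmul x y)

theorem norm_uncurryCLM_le (b : X →L[ℝ] Y →L[ℝ] Z) : ‖uncurryCLM b‖ ≤ ‖b‖ :=
  LinearMap.opNorm_extendOfNorm_le (denseRange_ofAlg X Y) (norm_nonneg b) (norm_lift_le_mul_norm_ofAlg b)

/-- Bounded bilinear maps are the same as bounded linear maps on the projective tensor product,
isometrically. -/
noncomputable def uncurry (X Y Z : Ban.{u}) :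
    (X →L[ℝ] Y →L[ℝ] Z) ≃ₗᵢ[ℝ] (tensor X Y →L[ℝ] Z) where
  toFun := uncurryCLM
  invFun f := (ContinuousLinearMap.compL ℝ Y (tensor X Y) Z f).comp (tmul X Y)
  left_inv b := by ext x y; simp
  right_inv f := clm_tensor_ext fun x y => by simp
  map_add' b b' := clm_tensor_ext fun x y => by simp
  map_smul' c b := clm_tensor_ext fun x y => by simp
  norm_map' b := by
    -- Only `‖x ⊗ y‖ ≤ ‖x‖ * ‖y‖` is needed here, not equality.
    refine (norm_uncurryCLM_le b).antisymm (b.opNorm_le_bound₂ (norm_nonneg _) fun x y => ?_)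
    rw [← uncurryCLM_tmul b x y, mul_assoc]
    exact ContinuousLinearMap.le_opNorm_of_le _ (norm_tmul_le x y)

@[simp]
theorem uncurry_symm_apply (f : tensor X Y →L[ℝ] Z) (x : X) (y : Y) :
    (uncurry X Y Z).symm f x y = f (tmul X Y x y) := rfl

/-- The morphism on the projective tensor product induced by a short bilinear map. -/
noncomputable def lift (b : X →L[ℝ] Y →L[ℝ] Z) (hb : ∀ x y, ‖b x y‖ ≤ ‖x‖ * ‖y‖) :
    tensor X Y ⟶ Z :=
  Hom.mk (uncurry X Y Z b) <| by
    rw [LinearIsometryEquiv.norm_map]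
    exact b.opNorm_le_bound₂ zero_le_one fun x y => (hb x y).trans_eq (by rw [one_mul])

@[simp]
theorem clm_lift_tmul (b : X →L[ℝ] Y →L[ℝ] Z) (hb : ∀ x y, ‖b x y‖ ≤ ‖x‖ * ‖y‖) (x : X) (y : Y) :
    clm (lift b hb) (tmul X Y x y) = b x y :=
  uncurryCLM_tmul b x y

theorem hom_tensor_ext {f g : tensor X Y ⟶ Z}
    (h : ∀ x y, clm f (tmul X Y x y) = clm g (tmul X Y x y)) : f = g :=
  clm_injective _ _ (clm_tensor_ext h)

/-- With `z` fixed, both sides are bounded linear in the inner tensor, so density applies a second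
time. -/
theorem hom_tensor_ext_left {W : Ban.{u}} {f g : tensor (tensor X Y) Z ⟶ W}
    (h : ∀ x y z, clm f (tmul _ _ (tmul _ _ x y) z) = clm g (tmul _ _ (tmul _ _ x y) z)) :
    f = g := by
  refine hom_tensor_ext fun t z => ?_
  have h' : (clm f).comp ((tmul (tensor X Y) Z).flip z) =
      (clm g).comp ((tmul (tensor X Y) Z).flip z) := clm_tensor_ext fun x y => h x y z
  exact DFunLike.congr_fun h' t

theorem hom_tensor_ext_right {W : Ban.{u}} {f g : tensor X (tensor Y Z) ⟶ W}
    (h : ∀ x y z, clm f (tmul _ _ x (tmul _ _ y z)) = clm g (tmul _ _ x (tmul _ _ y z))) :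
    f = g := by
  refine hom_tensor_ext fun x t => ?_
  have h' : (clm f).comp (tmul X (tensor Y Z) x) =
      (clm g).comp (tmul X (tensor Y Z) x) := clm_tensor_ext fun y z => h x y z
  exact DFunLike.congr_fun h' t

theorem hom_tensor_ext_left_left {V W : Ban.{u}} {f g : tensor (tensor (tensor X Y) Z) V ⟶ W}
    (h : ∀ x y z v, clm f (tmul _ _ (tmul _ _ (tmul _ _ x y) z) v) =
      clm g (tmul _ _ (tmul _ _ (tmul _ _ x y) z) v)) :
    f = g := by
  refine hom_tensor_ext_left fun t z v => ?_
  have h' : ((clm f).comp ((tmul _ V).flip v)).comp ((tmul (tensor X Y) Z).flip z) =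
      ((clm g).comp ((tmul _ V).flip v)).comp ((tmul (tensor X Y) Z).flip z) :=
    clm_tensor_ext fun x y => h x y z v
  exact DFunLike.congr_fun h' t

end Tensor

/-! ### The symmetric monoidal structure -/

section Structure

/-- The tensor product of two morphisms. -/
noncomputable def tensorMap {X Y X' Y' : Ban.{u}} (f : X ⟶ Y) (g : X' ⟶ Y') :
    tensor X X' ⟶ tensor Y Y' :=
  lift ((tmul Y Y').bilinearComp (clm f) (clm g)) fun x x' =>
    (norm_tmul_le _ _).trans <| mul_le_mul (norm_clm_apply_le f x) (norm_clm_apply_le g x')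
      (norm_nonneg _) (norm_nonneg _)

@[simp]
theorem tensorMap_tmul {X Y X' Y' : Ban.{u}} (f : X ⟶ Y) (g : X' ⟶ Y') (x : X) (x' : X') :
    clm (tensorMap f g) (tmul X X' x x') = tmul Y Y' (clm f x) (clm g x') :=
  clm_lift_tmul _ _ x x'

theorem norm_tensorMap_sub_le {X Y X' Y' : Ban.{u}} (f g : X ⟶ Y) (f' g' : X' ⟶ Y') :
    ‖clm (tensorMap f f') - clm (tensorMap g g')‖ ≤ ‖clm f - clm g‖ + ‖clm f' - clm g'‖ := by
  -- The isometry reduces the operator norm to a bilinear bound on elementary tensors, where the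
  -- difference telescopes.
  rw [← (uncurry X X' (tensor Y Y')).symm.norm_map]
  refine ContinuousLinearMap.opNorm_le_bound₂ _ (by positivity) fun x x' => ?_
  have h : (uncurry X X' (tensor Y Y')).symm (clm (tensorMap f f') - clm (tensorMap g g')) x x' =
      tmul Y Y' ((clm f - clm g) x) (clm f' x') + tmul Y Y' (clm g x) ((clm f' - clm g') x') := by
    simp
  rw [h, mul_assoc, add_mul]
  refine (norm_add_le _ _).trans (add_le_add ?_ ?_)
  · rw [← mul_assoc]
    exact (norm_tmul_le _ _).trans <| mul_le_mul ((clm f - clm g).le_opNorm x)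
      (norm_clm_apply_le f' x') (norm_nonneg _) (by positivity)
  · rw [mul_left_comm]
    exact (norm_tmul_le _ _).trans <| mul_le_mul (norm_clm_apply_le g x)
      ((clm f' - clm g').le_opNorm x') (norm_nonneg _) (by positivity)

/-- Currying, as a bijection of hom-sets. -/
noncomputable def curryEquiv (X Y Z : Ban.{u}) : (tensor X Y ⟶ Z) ≃ (X ⟶ (lhom Y).obj Z) where
  toFun f := Hom.mk ((uncurry X Y Z).symm (clm f))
    (((uncurry X Y Z).symm.norm_map _).trans_le (norm_clm_le f))
  invFun g := Hom.mk (uncurry X Y Z (clm g))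
    (((uncurry X Y Z).norm_map _).trans_le (norm_clm_le g))
  left_inv f := clm_injective _ _ ((uncurry X Y Z).apply_symm_apply (clm f))
  right_inv g := clm_injective _ _ ((uncurry X Y Z).symm_apply_apply (clm g))

theorem curryEquiv_symm_tmul {X Y Z : Ban.{u}} (g : X ⟶ (lhom Y).obj Z) (x : X) (y : Y) :
    clm ((curryEquiv X Y Z).symm g) (tmul X Y x y) = asMap (clm g x) y :=
  uncurryCLM_tmul (clm g) x y

theorem isometry_curryEquiv (X Y Z : Ban.{u}) : Isometry (curryEquiv X Y Z) := fun f g =>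
  (uncurry X Y Z).symm.isometry (clm f) (clm g)

/-- The coevaluation `x ↦ (y ↦ x ⊗ y)`. -/
noncomputable def coev (X Y : Ban.{u}) : X ⟶ (lhom Y).obj (tensor X Y) :=
  curryEquiv X Y _ (𝟙 _)

/-- Internal currying, from `(Y ⊗ Z) ⊸ W` to `Y ⊸ (Z ⊸ W)`. -/
noncomputable def internalCurry (Y Z W : Ban.{u}) :
    (lhom (tensor Y Z)).obj W ⟶ (lhom Y).obj ((lhom Z).obj W) :=
  Hom.mk (uncurry Y Z W).symm.toLinearIsometry.toContinuousLinearMap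
    (LinearIsometry.norm_toContinuousLinearMap_le _)

/-- Internal uncurrying, from `Y ⊸ (Z ⊸ W)` to `(Y ⊗ Z) ⊸ W`. -/
noncomputable def internalUncurry (Y Z W : Ban.{u}) :
    (lhom Y).obj ((lhom Z).obj W) ⟶ (lhom (tensor Y Z)).obj W :=
  Hom.mk (uncurry Y Z W).toLinearIsometry.toContinuousLinearMap
    (LinearIsometry.norm_toContinuousLinearMap_le _)

/-- The map `(x ⊗ y) ⊗ z ↦ x ⊗ (y ⊗ z)`. -/
noncomputable def assocHom (X Y Z : Ban.{u}) :
    tensor (tensor X Y) Z ⟶ tensor X (tensor Y Z) :=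
  -- Building the map from currying isometries makes its shortness automatic.
  (curryEquiv _ _ _).symm <| (curryEquiv _ _ _).symm <|
    coev X (tensor Y Z) ≫ internalCurry Y Z _

@[simp]
theorem assocHom_tmul {X Y Z : Ban.{u}} (x : X) (y : Y) (z : Z) :
    clm (assocHom X Y Z) (tmul _ _ (tmul _ _ x y) z) = tmul _ _ x (tmul _ _ y z) := by
  rw [assocHom, curryEquiv_symm_tmul, curryEquiv_symm_tmul]
  rfl

/-- The map `x ⊗ (y ⊗ z) ↦ (x ⊗ y) ⊗ z`. -/
noncomputable def assocInv (X Y Z : Ban.{u}) :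
    tensor X (tensor Y Z) ⟶ tensor (tensor X Y) Z :=
  (curryEquiv _ _ _).symm <|
    coev X Y ≫ (lhom Y).map (coev (tensor X Y) Z) ≫ internalUncurry Y Z _

@[simp]
theorem assocInv_tmul {X Y Z : Ban.{u}} (x : X) (y : Y) (z : Z) :
    clm (assocInv X Y Z) (tmul _ _ x (tmul _ _ y z)) = tmul _ _ (tmul _ _ x y) z := by
  rw [assocInv, curryEquiv_symm_tmul]
  exact uncurryCLM_tmul (X := Y) (Y := Z) _ y z

/-- The unit object, a copy of `ℝ`. -/
noncomputable def unit : Ban.{u} := Ban.mk (ULift.{u} ℝ)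

/-- The identification of `ℝ` with the unit object. -/
noncomputable def unitEquiv : ℝ ≃ₗᵢ[ℝ] unit.{u} := (LinearIsometryEquiv.ulift ℝ ℝ).symm

/-- The map `r ⊗ x ↦ r x`. -/
noncomputable def leftUnitorHom (X : Ban.{u}) : tensor unit X ⟶ X :=
  lift ((ContinuousLinearMap.lsmul ℝ ℝ).comp
    unitEquiv.{u}.symm.toLinearIsometry.toContinuousLinearMap) fun r x =>
    ((norm_smul _ _).trans (by rw [← unitEquiv.{u}.symm.norm_map r]; rfl)).le

@[simp]
theorem leftUnitorHom_tmul {X : Ban.{u}} (r : unit.{u}) (x : X) :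
    clm (leftUnitorHom X) (tmul _ _ r x) = unitEquiv.{u}.symm r • x :=
  clm_lift_tmul _ _ r x

/-- The map `x ⊗ y ↦ y ⊗ x`. -/
noncomputable def swap (X Y : Ban.{u}) : tensor X Y ⟶ tensor Y X :=
  lift (tmul Y X).flip fun x y => (norm_tmul_le y x).trans_eq (mul_comm _ _)

@[simp]
theorem swap_tmul {X Y : Ban.{u}} (x : X) (y : Y) :
    clm (swap X Y) (tmul _ _ x y) = tmul _ _ y x :=
  clm_lift_tmul _ _ x y

/-- The symmetry `X ⊗ Y ≅ Y ⊗ X`. -/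
noncomputable def swapIso (X Y : Ban.{u}) : tensor X Y ≅ tensor Y X where
  hom := swap X Y
  inv := swap Y X
  hom_inv_id := hom_tensor_ext fun x y => by simp
  inv_hom_id := hom_tensor_ext fun x y => by simp

/-- The associativity isomorphism. -/
noncomputable def assocIso (X Y Z : Ban.{u}) :
    tensor (tensor X Y) Z ≅ tensor X (tensor Y Z) where
  hom := assocHom X Y Z
  inv := assocInv X Y Z
  hom_inv_id := hom_tensor_ext_left fun x y z => by simp
  inv_hom_id := hom_tensor_ext_right fun x y z => by simp

/-- The map `x ↦ 1 ⊗ x`. -/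
noncomputable def leftUnitorInv (X : Ban.{u}) : X ⟶ tensor unit X :=
  Hom.mk (tmul unit X (unitEquiv 1)) <|
    ContinuousLinearMap.opNorm_le_bound _ zero_le_one fun x =>
      (norm_tmul_le _ _).trans_eq (by rw [LinearIsometryEquiv.norm_map, norm_one])

theorem leftUnitorInv_apply {X : Ban.{u}} (x : X) :
    clm (leftUnitorInv X) x = tmul unit X (unitEquiv 1) x := rfl

/-- The isomorphism `ℝ ⊗ X ≅ X`. -/
noncomputable def leftUnitorIso (X : Ban.{u}) : tensor unit X ≅ X where
  hom := leftUnitorHom X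
  inv := leftUnitorInv X
  hom_inv_id := hom_tensor_ext fun r x => by
    obtain ⟨r, rfl⟩ := unitEquiv.{u}.surjective r
    -- Moving the scalar across the tensor turns `r ⊗ x` into `1 ⊗ r x`.
    have h : unitEquiv.{u} r = r • unitEquiv.{u} 1 := by rw [← map_smul, smul_eq_mul, mul_one]
    simp [leftUnitorInv_apply, h]
  inv_hom_id := by
    apply clm_injective
    ext x
    simp [leftUnitorInv_apply]

/-- The tensor product, unit and structural isomorphisms of `Ban`. -/
noncomputable abbrev monoidalCategoryStruct : MonoidalCategoryStruct Ban.{u} where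
  tensorObj := tensor
  tensorUnit := unit
  tensorHom := tensorMap
  whiskerLeft X _ _ f := tensorMap (𝟙 X) f
  whiskerRight f Y := tensorMap f (𝟙 Y)
  associator := assocIso
  leftUnitor := leftUnitorIso
  -- Defined through the symmetry, so its naturality follows from that of the swap and the left
  -- unitor.
  rightUnitor X := swapIso X unit ≪≫ leftUnitorIso X

attribute [local instance] monoidalCategoryStruct

/-! ### Naturality and coherence -/

theorem tensorMap_id (X Y : Ban.{u}) : tensorMap (𝟙 X) (𝟙 Y) = 𝟙 (tensor X Y) :=
  hom_tensor_ext fun x y => by simp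

theorem tensorMap_comp {X Y Z X' Y' Z' : Ban.{u}} (f : X ⟶ Y) (f' : X' ⟶ Y') (g : Y ⟶ Z)
    (g' : Y' ⟶ Z') : tensorMap f f' ≫ tensorMap g g' = tensorMap (f ≫ g) (f' ≫ g') :=
  hom_tensor_ext fun x y => by simp

theorem assocHom_naturality {X₁ X₂ X₃ Y₁ Y₂ Y₃ : Ban.{u}} (f₁ : X₁ ⟶ Y₁) (f₂ : X₂ ⟶ Y₂)
    (f₃ : X₃ ⟶ Y₃) :
    tensorMap (tensorMap f₁ f₂) f₃ ≫ assocHom Y₁ Y₂ Y₃ =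
      assocHom X₁ X₂ X₃ ≫ tensorMap f₁ (tensorMap f₂ f₃) :=
  hom_tensor_ext_left fun x y z => by simp

theorem leftUnitorHom_naturality {X Y : Ban.{u}} (f : X ⟶ Y) :
    tensorMap (𝟙 unit) f ≫ leftUnitorHom Y = leftUnitorHom X ≫ f :=
  hom_tensor_ext fun r x => by simp

theorem swap_naturality {X Y X' Y' : Ban.{u}} (f : X ⟶ Y) (g : X' ⟶ Y') :
    tensorMap f g ≫ swap Y Y' = swap X X' ≫ tensorMap g f :=
  hom_tensor_ext fun x y => by simp

theorem assocHom_pentagon (W X Y Z : Ban.{u}) :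
    tensorMap (assocHom W X Y) (𝟙 Z) ≫ assocHom W (tensor X Y) Z ≫
        tensorMap (𝟙 W) (assocHom X Y Z) =
      assocHom (tensor W X) Y Z ≫ assocHom W X (tensor Y Z) :=
  hom_tensor_ext_left_left fun w x y z => by simp

theorem assocHom_triangle (X Y : Ban.{u}) :
    assocHom X unit Y ≫ tensorMap (𝟙 X) (leftUnitorHom Y) =
      tensorMap (swap X unit ≫ leftUnitorHom X) (𝟙 Y) :=
  hom_tensor_ext_left fun x r y => by simp

theorem swap_hexagon_forward (X Y Z : Ban.{u}) :
    assocHom X Y Z ≫ swap X (tensor Y Z) ≫ assocHom Y Z X =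
      tensorMap (swap X Y) (𝟙 Z) ≫ assocHom Y X Z ≫ tensorMap (𝟙 Y) (swap X Z) :=
  hom_tensor_ext_left fun x y z => by simp

theorem swap_hexagon_reverse (X Y Z : Ban.{u}) :
    assocInv X Y Z ≫ swap (tensor X Y) Z ≫ assocInv Z X Y =
      tensorMap (𝟙 X) (swap Y Z) ≫ assocInv X Z Y ≫ tensorMap (swap X Z) (𝟙 Y) :=
  hom_tensor_ext_right fun x y z => by simp

/-- The monoidal structure of the projective tensor product. -/
noncomputable abbrev monoidalCategory : MonoidalCategory Ban.{u} :=
  MonoidalCategory.ofTensorHom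
    (id_tensorHom_id := tensorMap_id)
    (id_tensorHom := fun _ _ _ _ => rfl)
    (tensorHom_id := fun _ _ => rfl)
    (tensorHom_comp_tensorHom := tensorMap_comp)
    (associator_naturality := assocHom_naturality)
    (leftUnitor_naturality := leftUnitorHom_naturality)
    (rightUnitor_naturality := fun {X Y} f => by
      change tensorMap f (𝟙 unit) ≫ swap Y unit ≫ leftUnitorHom Y =
        (swap X unit ≫ leftUnitorHom X) ≫ f
      rw [← Category.assoc, swap_naturality, Category.assoc, leftUnitorHom_naturality,
        Category.assoc])
    (pentagon := assocHom_pentagon)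
    (triangle := assocHom_triangle)

attribute [local instance] monoidalCategory

/-- The symmetric monoidal structure of the projective tensor product. -/
noncomputable abbrev symmetricCategory : SymmetricCategory Ban.{u} where
  braiding := swapIso
  braiding_naturality_right X _ _ f := swap_naturality (𝟙 X) f
  braiding_naturality_left f Z := swap_naturality f (𝟙 Z)
  hexagon_forward := swap_hexagon_forward
  hexagon_reverse := swap_hexagon_reverse
  symmetry X Y := (swapIso X Y).hom_inv_id

attribute [local instance] symmetricCategory

/-- The adjunction between `- ⊗ Y` and `Y ⊸ -`, given by currying. -/
noncomputable def curryAdjunction (Y : Ban.{u}) : tensorRight Y ⊣ lhom Y :=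
  Adjunction.mkOfHomEquiv
    { homEquiv := fun X Z => curryEquiv X Y Z
      homEquiv_naturality_left_symm := fun {X' X Z} f g => by
        refine hom_tensor_ext (X := X') (Y := Y) fun x y => ?_
        change _ = clm ((curryEquiv X Y Z).symm g) (clm (tensorMap f (𝟙 Y)) (tmul X' Y x y))
        rw [tensorMap_tmul, curryEquiv_symm_tmul, curryEquiv_symm_tmul]
        rfl
      homEquiv_naturality_right := fun _ _ => rfl }

/-! ### Values on elementary tensors and `Met`-enrichment -/

theorem curryAdjunction_homEquiv (X Y Z : Ban.{u}) :
    (curryAdjunction Y).homEquiv X Z = curryEquiv X Y Z := by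
  rw [curryAdjunction, Adjunction.mkOfHomEquiv_homEquiv]

theorem isProjectiveMonoidal_tensor : IsProjectiveMonoidal unitEquiv.{u} tmulₗ where
  isProjectiveTensor := isProjectiveTensor_tmulₗ
  tensorHom_apply := tensorMap_tmul
  associator_apply _ _ _ := assocHom_tmul
  leftUnitor_apply X r x := (leftUnitorHom_tmul (unitEquiv r) x).trans
    (by rw [LinearIsometryEquiv.symm_apply_apply])
  rightUnitor_apply X r x := by
    change clm (leftUnitorHom X) (clm (swap X unit) (tmul X unit x (unitEquiv r))) = _
    rw [swap_tmul, leftUnitorHom_tmul, LinearIsometryEquiv.symm_apply_apply]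
  braiding_apply _ _ := swap_tmul

theorem isCurrying_curryAdjunction : IsCurrying.{u} tmulₗ curryAdjunction := by
  intro X Y Z f x y
  rw [curryAdjunction_homEquiv]
  rfl

theorem isMetTensor : IsMetTensor Ban.{u} := fun _ _ _ _ f g f' g' =>
  edist_hom_le_add (norm_tensorMap_sub_le f g f' g')

theorem isMetEnrichedAutonomous : IsMetEnrichedAutonomous Ban.{u} lhom curryAdjunction where
  metCategory := isMetCategory
  metTensor := isMetTensor
  metAdjunction Y :=
    { left := fun X X' f g => by
        -- `- ⊗ Y` is the tensor with an identity, which contributes distance zero.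
        have h := isMetTensor X X' Y Y f g (𝟙 Y) (𝟙 Y)
        rw [edist_self, add_zero] at h
        rw [ENNReal.coe_one, one_mul]
        exact h
      right := isMetFunctor_lhom Y
      isometry := fun X Z => by
        rw [curryAdjunction_homEquiv]
        exact isometry_curryEquiv X Y Z }

end Structure

end Ban

theorem mainTheorem7 :
    ∃ (_ : MonoidalCategory Ban.{u}) (_ : SymmetricCategory Ban.{u})
      (ι : ℝ ≃ₗᵢ[ℝ] (𝟙_ Ban.{u} : Ban.{u}))
      (τ : ∀ X Y : Ban.{u}, X →ₗ[ℝ] Y →ₗ[ℝ] (X ⊗ Y : Ban.{u}))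
      (adj : ∀ Y : Ban.{u}, tensorRight Y ⊣ Ban.lhom Y),
      Ban.IsProjectiveMonoidal ι τ ∧ Ban.IsCurrying τ adj ∧
        IsMetEnrichedAutonomous Ban.{u} Ban.lhom adj :=
  ⟨Ban.monoidalCategory, Ban.symmetricCategory, Ban.unitEquiv, Ban.tmulₗ, Ban.curryAdjunction,
    Ban.isProjectiveMonoidal_tensor, Ban.isCurrying_curryAdjunction, Ban.isMetEnrichedAutonomous⟩
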